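/- Let $M$ be a compact complex manifold of complex dimension $m$, let $(N,g)$ be a smooth Riemannian manifold of dimension $n$, and let $f\colon M\to N$ be a pluri-harmonic map; that is, $f$ is smooth and $\partial_E\bar\partial f=0$, where $E=f^*(TN)$ (complexified) carries the connection induced by the Levi-Civita connection of $g$. In local holomorphic coordinates $(z^\alpha)$ on $M$ and local coordinates on $N$, with Christoffel symbols $\Gamma^i_{jk}$, this means $$\frac{\partial^2 f^i}{\partial z^\alpha\partial\bar z^\beta}+\sum_{j,k}\Gamma^i_{jk}(f)\,\frac{\partial f^j}{\partial\bar z^\beta}\frac{\partial f^k}{\partial z^\alpha}=0\qquad\text{for all }\alpha,\beta,i.$$ Let $R(X,Y,Z,W)=g(\nabla_X\nabla_YZ-\nabla_Y\nabla_XZ-\nabla_{[X,Y]}Z,\,W)$ be the curvature tensor of $(N,g)$, with components $R_{ijk\ell}$ in local coordinates. Call $R$ Hermitian non-degenerate at $q\in N$ if every Hermitian positive semi-definite matrix $A=(A^{i\bar\ell})\in\mathbb C^{n\times n}$ with $$\sum_{i,j,k,\ell}R_{ijk\ell}(q)\,A^{i\bar\ell}A^{j\bar k}=0$$ has complex rank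 at most $1$; this condition does not depend on the coordinates chosen around $q$. If $p\in M$ and $R$ is Hermitian non-degenerate at $f(p)$, then $\operatorname{rank}_{\mathbb R}df(p)\le 2$. -/

import Mathlib

open scoped Manifold ContDiff ComplexOrder

noncomputable section

/-! ### Wirtinger derivatives on `ℂᵐ` -/

section Wirtinger

variable {m : ℕ}

/-- `∂u/∂z^α = (1/2) (∂u/∂x^α - √-1 ∂u/∂y^α)`, where `z^α = x^α + √-1 y^α`. -/
def dz (α : Fin m) (u : EuclideanSpace ℂ (Fin m) → ℂ) (z : EuclideanSpace ℂ (Fin m)) : ℂ :=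
  (1 / 2 : ℂ) * (fderiv ℝ u z (EuclideanSpace.single α 1)
    - Complex.I * fderiv ℝ u z (EuclideanSpace.single α Complex.I))

/-- `∂u/∂z̄^α = (1/2) (∂u/∂x^α + √-1 ∂u/∂y^α)`, where `z^α = x^α + √-1 y^α`. -/
def dzbar (α : Fin m) (u : EuclideanSpace ℂ (Fin m) → ℂ) (z : EuclideanSpace ℂ (Fin m)) : ℂ :=
  (1 / 2 : ℂ) * (fderiv ℝ u z (EuclideanSpace.single α 1)
    + Complex.I * fderiv ℝ u z (EuclideanSpace.single α Complex.I))

end Wirtinger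

/-! ### Levi-Civita connection and curvature in local coordinates -/

section Riemannian

variable {n : ℕ} {N : Type*} [TopologicalSpace N] [ChartedSpace (EuclideanSpace ℝ (Fin n)) N]
  [IsManifold 𝓘(ℝ, EuclideanSpace ℝ (Fin n)) ∞ N]

/-- A smooth Riemannian metric on the smooth `n`-manifold `N`. -/
abbrev SmoothMetric (n : ℕ) (N : Type*) [TopologicalSpace N]
    [ChartedSpace (EuclideanSpace ℝ (Fin n)) N]
    [IsManifold 𝓘(ℝ, EuclideanSpace ℝ (Fin n)) ∞ N] :=
  Bundle.ContMDiffRiemannianMetric 𝓘(ℝ, EuclideanSpace ℝ (Fin n)) ∞ (EuclideanSpace ℝ (Fin n))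
    (TangentSpace 𝓘(ℝ, EuclideanSpace ℝ (Fin n)) : N → Type)

/-- The coordinate vector field `∂/∂x^i` of the chart `ψ`, at the point `ψ⁻¹ y` with
coordinates `y`. -/
def coordVec (ψ : OpenPartialHomeomorph N (EuclideanSpace ℝ (Fin n)))
    (y : EuclideanSpace ℝ (Fin n)) (i : Fin n) :
    TangentSpace 𝓘(ℝ, EuclideanSpace ℝ (Fin n)) (ψ.symm y) :=
  mfderiv 𝓘(ℝ, EuclideanSpace ℝ (Fin n)) 𝓘(ℝ, EuclideanSpace ℝ (Fin n)) ψ.symm y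
    (EuclideanSpace.single i (1 : ℝ))

/-- The matrix `(g_{ij})` of the metric in the chart `ψ`, as a function of the coordinates. -/
def metricMatrix (g : SmoothMetric n N) (ψ : OpenPartialHomeomorph N (EuclideanSpace ℝ (Fin n)))
    (y : EuclideanSpace ℝ (Fin n)) : Matrix (Fin n) (Fin n) ℝ :=
  Matrix.of fun i j => g.inner (ψ.symm y) (coordVec ψ y i) (coordVec ψ y j)

/-- `∂u/∂x^i` on `ℝⁿ`. -/
def dx (i : Fin n) (u : EuclideanSpace ℝ (Fin n) → ℝ) (y : EuclideanSpace ℝ (Fin n)) : ℝ :=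
  fderiv ℝ u y (EuclideanSpace.single i (1 : ℝ))

/-- The Christoffel symbol
`Γ^k_{ij} = (1/2) g^{kl} (∂_i g_{jl} + ∂_j g_{il} - ∂_l g_{ij})` of the Levi-Civita connection
in the chart `ψ`; the arguments are in the order `k i j`. -/
def christoffel (g : SmoothMetric n N) (ψ : OpenPartialHomeomorph N (EuclideanSpace ℝ (Fin n)))
    (k i j : Fin n) (y : EuclideanSpace ℝ (Fin n)) : ℝ :=
  (1 / 2 : ℝ) * ∑ l, (metricMatrix g ψ y)⁻¹ k l *
    (dx i (fun y' => metricMatrix g ψ y' j l) y + dx j (fun y' => metricMatrix g ψ y' i l) y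
      - dx l (fun y' => metricMatrix g ψ y' i j) y)

/-- The components `R_{ijkl} = R(∂_i, ∂_j, ∂_k, ∂_l)` in the chart `ψ` of the curvature tensor
`R(X, Y, Z, W) = g(∇_X ∇_Y Z - ∇_Y ∇_X Z - ∇_{[X,Y]} Z, W)`. -/
def curvature (g : SmoothMetric n N) (ψ : OpenPartialHomeomorph N (EuclideanSpace ℝ (Fin n)))
    (i j k l : Fin n) (y : EuclideanSpace ℝ (Fin n)) : ℝ :=
  ∑ p, metricMatrix g ψ y p l *
    (dx i (christoffel g ψ p j k) y - dx j (christoffel g ψ p i k) y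
      + ∑ q, (christoffel g ψ p i q y * christoffel g ψ q j k y
        - christoffel g ψ p j q y * christoffel g ψ q i k y))

/-- The curvature tensor of `(N, g)` is Hermitian non-degenerate at `q`: a Hermitian positive
semi-definite matrix `A = (A^{i l̄})` with `R_{ijkl}(q) A^{i l̄} A^{j k̄} = 0` has rank `≤ 1`.
The components are those in the preferred chart at `q`; since `R` is a tensor, the condition
is the same in every other chart around `q`. -/
def HermitianNondegenerateAt (g : SmoothMetric n N) (q : N) : Prop :=
  ∀ A : Matrix (Fin n) (Fin n) ℂ, A.PosSemidef →
    (∑ i, ∑ j, ∑ k, ∑ l,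
      (curvature g (chartAt (EuclideanSpace ℝ (Fin n)) q) i j k l
        (chartAt (EuclideanSpace ℝ (Fin n)) q q) : ℂ) * A i l * A j k) = 0 →
    A.rank ≤ 1

end Riemannian

/-! ### Pluri-harmonic maps -/

section PluriHarmonic

variable {m n : ℕ} {M : Type*} [TopologicalSpace M] [ChartedSpace (EuclideanSpace ℂ (Fin m)) M]
  {N : Type*} [TopologicalSpace N] [ChartedSpace (EuclideanSpace ℝ (Fin n)) N]
  [IsManifold 𝓘(ℝ, EuclideanSpace ℝ (Fin n)) ∞ N]

/-- The component `f^i` of `f : M → N`, read in the charts `φ` of `M` and `ψ` of `N`. -/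
def localComp (φ : OpenPartialHomeomorph M (EuclideanSpace ℂ (Fin m)))
    (ψ : OpenPartialHomeomorph N (EuclideanSpace ℝ (Fin n))) (f : M → N) (i : Fin n)
    (z : EuclideanSpace ℂ (Fin m)) : ℂ :=
  ((ψ (f (φ.symm z)) i : ℝ) : ℂ)

/-- A map `f` from a complex manifold `M` to a Riemannian manifold `(N, g)` is pluri-harmonic,
`∂_E ∂̄ f = 0` for `E = f^*(TN)` with the induced Levi-Civita connection, if it is smooth and,
in all local holomorphic coordinates `z^α` of `M` and local coordinates of `N`,
`∂²f^i/∂z^α∂z̄^β + Γ^i_{jk} (∂f^j/∂z̄^β) (∂f^k/∂z^α) = 0` for all `α`, `β`, `i`. -/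
structure IsPluriHarmonic (g : SmoothMetric n N) (f : M → N) : Prop where
  smooth : ContMDiff 𝓘(ℝ, EuclideanSpace ℂ (Fin m)) 𝓘(ℝ, EuclideanSpace ℝ (Fin n)) ∞ f
  equation : ∀ φ ∈ atlas (EuclideanSpace ℂ (Fin m)) M,
    ∀ ψ ∈ atlas (EuclideanSpace ℝ (Fin n)) N,
    ∀ z ∈ φ.target, f (φ.symm z) ∈ ψ.source →
    ∀ (α β : Fin m) (i : Fin n),
      dz α (dzbar β (localComp φ ψ f i)) z
        + ∑ j, ∑ k, (christoffel g ψ i j k (ψ (f (φ.symm z))) : ℂ)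
          * dzbar β (localComp φ ψ f j) z * dz α (localComp φ ψ f k) z = 0

end PluriHarmonic

end

/-! Differentiate the pluri-harmonic equation along $z^\gamma$ and antisymmetrize in
$\alpha,\gamma$. The third derivatives cancel because mixed derivatives commute, the terms with
$\partial_\gamma\partial_\alpha f$ cancel by symmetry, and substituting the equation for
$\partial_\alpha\bar\partial_\beta f$ turns the rest into $R(\partial_\alpha f,\partial_\gamma
f)\,\overline{\partial_\beta f}=0$ (`curvature_integrability`, lowered in `curvature_dz_dz_dzbar`);
here $f$ is real, so $\bar\partial_\beta f$ is the conjugate of $\partial_\beta f$.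

Let $U=(\partial f^i/\partial z^\alpha)$. Setting $\gamma=\beta$, pairing with
$\overline{\partial_\alpha f}$ and summing gives $R_{ijk\ell}A^{i\bar\ell}A^{j\bar k}=0$ for the
positive semi-definite $A=UU^*$ (`sum_mul_conjTranspose_eq_zero`). Non-degeneracy yields
$\operatorname{rank}U=\operatorname{rank}A\le1$. Since $df(w)=2\,\mathrm{Re}(Uw)$, the image of $df$
lies in the real part of at most a complex line (`rank_fderiv_le_two`). -/

noncomputable section

/-! ### Wirtinger calculus and the integrability condition -/

section WirtingerCalculus

variable {m : ℕ} {u v : EuclideanSpace ℂ (Fin m) → ℂ} {z : EuclideanSpace ℂ (Fin m)}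

/-- The linear functional on real differentials that computes `∂/∂z^α`. -/
def dzFunctional (α : Fin m) : (EuclideanSpace ℂ (Fin m) →L[ℝ] ℂ) →L[ℝ] ℂ :=
  (1 / 2 : ℂ) • (ContinuousLinearMap.apply ℝ ℂ (EuclideanSpace.single α (1 : ℂ))
    - Complex.I • ContinuousLinearMap.apply ℝ ℂ (EuclideanSpace.single α Complex.I))

/-- The linear functional on real differentials that computes `∂/∂z̄^α`. -/
def dzbarFunctional (α : Fin m) : (EuclideanSpace ℂ (Fin m) →L[ℝ] ℂ) →L[ℝ] ℂ :=
  (1 / 2 : ℂ) • (ContinuousLinearMap.apply ℝ ℂ (EuclideanSpace.single α (1 : ℂ))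
    + Complex.I • ContinuousLinearMap.apply ℝ ℂ (EuclideanSpace.single α Complex.I))

theorem dz_eq (α : Fin m) (u : EuclideanSpace ℂ (Fin m) → ℂ) :
    dz α u = fun z => dzFunctional α (fderiv ℝ u z) := by
  ext z; simp [dz, dzFunctional]

theorem dzbar_eq (α : Fin m) (u : EuclideanSpace ℂ (Fin m) → ℂ) :
    dzbar α u = fun z => dzbarFunctional α (fderiv ℝ u z) := by
  ext z; simp [dzbar, dzbarFunctional, mul_add]

theorem contDiffAt_dz {k l : ℕ∞ω} (α : Fin m) (hu : ContDiffAt ℝ k u z) (h : l + 1 ≤ k) :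
    ContDiffAt ℝ l (dz α u) z := by
  rw [dz_eq]
  exact (dzFunctional α).contDiff.contDiffAt.comp z (hu.fderiv_right h)

theorem contDiffAt_dzbar {k l : ℕ∞ω} (α : Fin m) (hu : ContDiffAt ℝ k u z) (h : l + 1 ≤ k) :
    ContDiffAt ℝ l (dzbar α u) z := by
  rw [dzbar_eq]
  exact (dzbarFunctional α).contDiff.contDiffAt.comp z (hu.fderiv_right h)

theorem dz_congr (α : Fin m) (h : u =ᶠ[nhds z] v) : dz α u z = dz α v z := by
  simp only [dz, h.fderiv_eq]

theorem dz_neg (α : Fin m) : dz α (fun z => -u z) z = -dz α u z := by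
  simp only [dz, fderiv_fun_neg, neg_apply]; ring

theorem dz_mul (α : Fin m) (hu : DifferentiableAt ℝ u z) (hv : DifferentiableAt ℝ v z) :
    dz α (fun z => u z * v z) z = dz α u z * v z + u z * dz α v z := by
  simp only [dz, fderiv_fun_mul hu hv, add_apply,
    smul_apply, smul_eq_mul]; ring

theorem dz_sum {ι : Type*} (α : Fin m) (s : Finset ι) {w : ι → EuclideanSpace ℂ (Fin m) → ℂ}
    (hw : ∀ i ∈ s, DifferentiableAt ℝ (w i) z) :
    dz α (fun z => ∑ i ∈ s, w i z) z = ∑ i ∈ s, dz α (w i) z := by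
  simp only [dz_eq, fderiv_fun_sum hw, map_sum]

/-- Both sides are the same combination of values of the real second differential, which is
symmetric. -/
theorem dz_dz_comm (α γ : Fin m) (hu : ContDiffAt ℝ 2 u z) :
    dz α (dz γ u) z = dz γ (dz α u) z := by
  have hd : DifferentiableAt ℝ (fderiv ℝ u) z :=
    (hu.fderiv_right (m := 1) (by norm_num)).differentiableAt (by norm_num)
  have hs : IsSymmSndFDerivAt ℝ u z := hu.isSymmSndFDerivAt (by simp)
  have key (δ : Fin m) (w : EuclideanSpace ℂ (Fin m)) :
      fderiv ℝ (dz δ u) z w = dzFunctional δ (fderiv ℝ (fderiv ℝ u) z w) := by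
    rw [dz_eq]
    have := ((dzFunctional δ).hasFDerivAt.comp z hd.hasFDerivAt).fderiv
    change fderiv ℝ ((dzFunctional δ) ∘ fderiv ℝ u) z w = _
    rw [this]; rfl
  simp only [dz_eq α (dz γ u), dz_eq γ (dz α u)]
  simp only [dzFunctional, smul_apply, sub_apply,
    ContinuousLinearMap.apply_apply, key, smul_eq_mul]
  rw [hs (EuclideanSpace.single α (1 : ℂ)) (EuclideanSpace.single γ (1 : ℂ)),
    hs (EuclideanSpace.single α (1 : ℂ)) (EuclideanSpace.single γ Complex.I),
    hs (EuclideanSpace.single α Complex.I) (EuclideanSpace.single γ (1 : ℂ)),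
    hs (EuclideanSpace.single α Complex.I) (EuclideanSpace.single γ Complex.I)]
  ring

variable {n : ℕ} {F : EuclideanSpace ℂ (Fin m) → EuclideanSpace ℝ (Fin n)}

/-- The `i`-th coordinate of `ℝⁿ`, with values in `ℂ`. -/
def componentCLM (i : Fin n) : EuclideanSpace ℝ (Fin n) →L[ℝ] ℂ :=
  Complex.ofRealCLM.comp (EuclideanSpace.proj i : EuclideanSpace ℝ (Fin n) →L[ℝ] ℝ)

theorem fderiv_ofReal_component (hF : DifferentiableAt ℝ F z) (i : Fin n)
    (w : EuclideanSpace ℂ (Fin m)) :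
    fderiv ℝ (fun z => ((F z i : ℝ) : ℂ)) z w = ((fderiv ℝ F z w i : ℝ) : ℂ) := by
  have := ((componentCLM i).hasFDerivAt.comp z hF.hasFDerivAt).fderiv
  change fderiv ℝ (componentCLM i ∘ F) z w = _
  rw [this]; rfl

theorem contDiffAt_ofReal_component {k : ℕ∞ω} (hF : ContDiffAt ℝ k F z) (i : Fin n) :
    ContDiffAt ℝ k (fun z => ((F z i : ℝ) : ℂ)) z :=
  (componentCLM i).contDiff.contDiffAt.comp z hF

theorem fderiv_apply_eq_sum_dx {h : EuclideanSpace ℝ (Fin n) → ℝ} (y w : EuclideanSpace ℝ (Fin n)) :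
    fderiv ℝ h y w = ∑ p, dx p h y * w p := by
  conv_lhs => rw [← (EuclideanSpace.basisFun (Fin n) ℝ).sum_repr w]
  simp [dx, mul_comm]

theorem differentiableAt_ofReal_comp {h : EuclideanSpace ℝ (Fin n) → ℝ}
    (hh : DifferentiableAt ℝ h (F z)) (hF : DifferentiableAt ℝ F z) :
    DifferentiableAt ℝ (fun z => ((h (F z) : ℝ) : ℂ)) z :=
  Complex.ofRealCLM.differentiableAt.comp z (hh.comp z hF)

theorem dz_ofReal_comp {h : EuclideanSpace ℝ (Fin n) → ℝ} (α : Fin m)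
    (hh : DifferentiableAt ℝ h (F z)) (hF : DifferentiableAt ℝ F z) :
    dz α (fun z => ((h (F z) : ℝ) : ℂ)) z
      = ∑ p, (dx p h (F z) : ℂ) * dz α (fun z => ((F z p : ℝ) : ℂ)) z := by
  have key (w : EuclideanSpace ℂ (Fin m)) : fderiv ℝ (fun z => ((h (F z) : ℝ) : ℂ)) z w
      = ∑ p, (dx p h (F z) : ℂ) * ((fderiv ℝ F z w p : ℝ) : ℂ) := by
    have := (Complex.ofRealCLM.hasFDerivAt.comp z
      (hh.hasFDerivAt.comp z hF.hasFDerivAt)).fderiv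
    change fderiv ℝ (Complex.ofRealCLM ∘ h ∘ F) z w = _
    rw [this]
    simp [fderiv_apply_eq_sum_dx]
  simp only [dz, key, fderiv_ofReal_component hF, mul_sub, Finset.mul_sum,
    ← Finset.sum_sub_distrib]
  exact Finset.sum_congr rfl fun p _ => by ring

theorem dzbar_ofReal_component (hF : DifferentiableAt ℝ F z) (α : Fin m) (i : Fin n) :
    dzbar α (fun z => ((F z i : ℝ) : ℂ)) z
      = starRingEnd ℂ (dz α (fun z => ((F z i : ℝ) : ℂ)) z) := by
  simp only [dz, dzbar, fderiv_ofReal_component hF, map_mul, map_sub, Complex.conj_ofReal,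
    Complex.conj_I, map_div₀, map_one, map_ofNat]
  ring

/-- A real component has differential $\partial f^i+\overline{\partial f^i}$. This recovers the real
rank from the complex matrix $U$. -/
theorem fderiv_component_eq_re_sum (hF : DifferentiableAt ℝ F z) (i : Fin n)
    (w : EuclideanSpace ℂ (Fin m)) :
    fderiv ℝ F z w i
      = (∑ α, 2 * (dz α (fun z => ((F z i : ℝ) : ℂ)) z * w α)).re := by
  have hw : w = ∑ α, ((w α).re • EuclideanSpace.single α (1 : ℂ)
      + (w α).im • EuclideanSpace.single α Complex.I) := by
    ext β
    simp [Finset.sum_apply, Pi.single_apply, Finset.sum_add_distrib]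
  conv_lhs => rw [hw]
  simp only [map_sum, map_add, map_smul, Complex.re_sum]
  simp only [WithLp.ofLp_sum, Finset.sum_apply]
  refine Finset.sum_congr rfl fun α _ => ?_
  simp [dz, fderiv_ofReal_component hF]
  ring

theorem sum_sum_sum_rotate {ι R : Type*} [AddCommMonoid R] (s : Finset ι) (f : ι → ι → ι → R) :
    ∑ a ∈ s, ∑ b ∈ s, ∑ c ∈ s, f a b c = ∑ c ∈ s, ∑ a ∈ s, ∑ b ∈ s, f a b c :=
  (Finset.sum_congr rfl fun _ _ => Finset.sum_comm).trans Finset.sum_comm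

/-- The algebra of the integrability condition: `a`, `c`, `b` stand for $\partial_\alpha f$,
$\partial_\gamma f$, $\bar\partial_\beta f$, and `S` for $\partial_\gamma\partial_\alpha f$. -/
theorem sum_antisymm_christoffel {ι R : Type*} [Fintype ι] [CommRing R] (dG : ι → ι → ι → R)
    (G : ι → ι → ι → R) (hdG : ∀ i j k, dG i j k = dG i k j) (hG : ∀ i j k, G i j k = G i k j)
    (p : ι) (a b c : ι → R) (S : ι → R)
    (h : (∑ j, ∑ k, (((∑ i, dG i j k * a i) * b j
        + G p j k * (-∑ s, ∑ t, G j s t * b s * a t)) * c k + G p j k * b j * S k))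
      = ∑ j, ∑ k, (((∑ i, dG i j k * c i) * b j
        + G p j k * (-∑ s, ∑ t, G j s t * b s * c t)) * a k + G p j k * b j * S k)) :
    ∑ i, ∑ j, ∑ k, (dG i j k - dG j i k + ∑ q, (G p i q * G q j k - G p j q * G q i k))
      * a i * c j * b k = 0 := by
  -- The two sides of `h` differ by swapping `a` and `c`, so one expansion serves both; its `S` part
  -- is unaffected by the swap and cancels.
  have key (a c : ι → R) : (∑ j, ∑ k, (((∑ i, dG i j k * a i) * b j
        + G p j k * (-∑ s, ∑ t, G j s t * b s * a t)) * c k + G p j k * b j * S k))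
      = ∑ i, ∑ j, ∑ k, (dG i j k - ∑ q, G p j q * G q i k) * a i * c j * b k
        + ∑ j, ∑ k, G p j k * b j * S k := by
    simp only [Finset.sum_add_distrib, sub_mul, Finset.sum_sub_distrib, mul_neg,
      ← sub_eq_add_neg]
    congr 2
    · simp only [Finset.sum_mul]
      rw [sum_sum_sum_rotate]
      refine Finset.sum_congr rfl fun i _ => ?_
      rw [Finset.sum_comm]
      refine Finset.sum_congr rfl fun j _ => Finset.sum_congr rfl fun k _ => ?_
      rw [hdG i k j]; ring
    · simp only [Finset.sum_mul, Finset.mul_sum]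
      rw [Finset.sum_comm]
      conv_rhs => rw [Finset.sum_comm]
      refine Finset.sum_congr rfl fun j _ => ?_
      rw [sum_sum_sum_rotate]
      refine Finset.sum_congr rfl fun i _ => ?_
      rw [Finset.sum_comm]
      refine Finset.sum_congr rfl fun k _ => Finset.sum_congr rfl fun q _ => ?_
      rw [hG p j q, hG q i k]; ring
  rw [key a c, key c a] at h
  have h' := add_right_cancel h
  conv_rhs at h' => rw [Finset.sum_comm]
  rw [← sub_eq_zero] at h'
  simp only [← Finset.sum_sub_distrib] at h'
  rw [← h']
  refine Finset.sum_congr rfl fun i _ => Finset.sum_congr rfl fun j _ =>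
    Finset.sum_congr rfl fun k _ => ?_
  rw [Finset.sum_sub_distrib]
  ring

/-- The integrability condition of the pluri-harmonic map equation. -/
theorem curvature_integrability {Γ : Fin n → Fin n → Fin n → EuclideanSpace ℝ (Fin n) → ℝ}
    (hF : ContDiffAt ℝ 3 F z) (hΓ : ∀ i j k, DifferentiableAt ℝ (Γ i j k) (F z))
    (hsymm : ∀ i j k, Γ i j k = Γ i k j)
    (heq : ∀ᶠ w in nhds z, ∀ (α β : Fin m) (i : Fin n),
      dz α (dzbar β (fun z => ((F z i : ℝ) : ℂ))) w
        + ∑ j, ∑ k, (Γ i j k (F w) : ℂ) * dzbar β (fun z => ((F z j : ℝ) : ℂ)) w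
          * dz α (fun z => ((F z k : ℝ) : ℂ)) w = 0)
    (α γ β : Fin m) (p : Fin n) :
    ∑ i, ∑ j, ∑ k, ((dx i (Γ p j k) (F z) - dx j (Γ p i k) (F z)
      + ∑ q, (Γ p i q (F z) * Γ q j k (F z) - Γ p j q (F z) * Γ q i k (F z)) : ℝ) : ℂ)
      * dz α (fun z => ((F z i : ℝ) : ℂ)) z * dz γ (fun z => ((F z j : ℝ) : ℂ)) z
      * dzbar β (fun z => ((F z k : ℝ) : ℂ)) z = 0 := by
  set u : Fin n → EuclideanSpace ℂ (Fin m) → ℂ := fun i z => ((F z i : ℝ) : ℂ) with hu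
  have hFd : DifferentiableAt ℝ F z := hF.differentiableAt (by norm_num)
  have hu3 (i : Fin n) : ContDiffAt ℝ 3 (u i) z := contDiffAt_ofReal_component hF i
  have hdz (α : Fin m) (i : Fin n) : DifferentiableAt ℝ (dz α (u i)) z :=
    (contDiffAt_dz (l := 2) α (hu3 i) (by norm_num)).differentiableAt (by norm_num)
  have hdzbar (i : Fin n) : ContDiffAt ℝ 2 (dzbar β (u i)) z :=
    contDiffAt_dzbar (l := 2) β (hu3 i) (by norm_num)
  have hdzbar' (i : Fin n) : DifferentiableAt ℝ (dzbar β (u i)) z :=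
    (hdzbar i).differentiableAt (by norm_num)
  have hG (i j k : Fin n) : DifferentiableAt ℝ (fun w => (Γ i j k (F w) : ℂ)) z :=
    differentiableAt_ofReal_comp (hΓ i j k) hFd
  have hE (α : Fin m) (i : Fin n) : dz α (dzbar β (u i)) z
      = -∑ j, ∑ k, (Γ i j k (F z) : ℂ) * dzbar β (u j) z * dz α (u k) z :=
    eq_neg_of_add_eq_zero_left (heq.self_of_nhds α β i)
  have third (γ α : Fin m) : dz γ (dz α (dzbar β (u p))) z
      = -∑ j, ∑ k, (((∑ i, (dx i (Γ p j k) (F z) : ℂ) * dz γ (u i) z) * dzbar β (u j) z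
        + (Γ p j k (F z) : ℂ) * dz γ (dzbar β (u j)) z) * dz α (u k) z
        + (Γ p j k (F z) : ℂ) * dzbar β (u j) z * dz γ (dz α (u k)) z) := by
    -- The equation is about to be differentiated, so it is needed near `z` and not only at `z`.
    have he : dz α (dzbar β (u p)) =ᶠ[nhds z] fun w =>
        -∑ j, ∑ k, (Γ p j k (F w) : ℂ) * dzbar β (u j) w * dz α (u k) w :=
      heq.mono fun w hw => eq_neg_of_add_eq_zero_left (hw α β p)
    rw [dz_congr γ he, dz_neg, dz_sum]
    · congr 1
      refine Finset.sum_congr rfl fun j _ => ?_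
      rw [dz_sum]
      · refine Finset.sum_congr rfl fun k _ => ?_
        rw [dz_mul γ (u := fun w => (Γ p j k (F w) : ℂ) * dzbar β (u j) w)
          ((hG p j k).mul (hdzbar' j)) (hdz α k), dz_mul γ (hG p j k) (hdzbar' j),
          dz_ofReal_comp γ (hΓ p j k) hFd]
      · exact fun k _ => ((hG p j k).mul (hdzbar' j)).mul (hdz α k)
    · exact fun j _ => DifferentiableAt.fun_sum fun k _ =>
        ((hG p j k).mul (hdzbar' j)).mul (hdz α k)
  have hcomm := dz_dz_comm α γ (hdzbar p)
  rw [third, third] at hcomm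
  simp only [hE, fun k => dz_dz_comm α γ ((hu3 k).of_le (by norm_num : (2 : ℕ∞ω) ≤ 3))] at hcomm
  have := sum_antisymm_christoffel (fun i j k => (dx i (Γ p j k) (F z) : ℂ))
    (fun i j k => (Γ i j k (F z) : ℂ)) (fun i j k => by rw [hsymm]) (fun i j k => by rw [hsymm])
    p (fun i => dz α (u i) z) (fun i => dzbar β (u i) z) (fun i => dz γ (u i) z)
    (fun i => dz γ (dz α (u i)) z) (neg_injective hcomm)
  simpa using this

end WirtingerCalculus

/-! ### Regularity of the metric and the Christoffel symbols in a chart -/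

section Riemannian

variable {n : ℕ} {N : Type*} [TopologicalSpace N] [ChartedSpace (EuclideanSpace ℝ (Fin n)) N]
  [IsManifold 𝓘(ℝ, EuclideanSpace ℝ (Fin n)) ∞ N]

/-- The coordinate field is the tangent map of `ψ.symm` applied to a constant vector field. -/
theorem contMDiffAt_coordVec {ψ : OpenPartialHomeomorph N (EuclideanSpace ℝ (Fin n))}
    (hψ : ψ ∈ atlas (EuclideanSpace ℝ (Fin n)) N) {y : EuclideanSpace ℝ (Fin n)}
    (hy : y ∈ ψ.target) (i : Fin n) :
    ContMDiffAt 𝓘(ℝ, EuclideanSpace ℝ (Fin n)) (𝓘(ℝ, EuclideanSpace ℝ (Fin n)).tangent) ∞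
      (fun y => (⟨ψ.symm y, coordVec ψ y i⟩ :
        TangentBundle 𝓘(ℝ, EuclideanSpace ℝ (Fin n)) N)) y := by
  have hs : ContMDiffOn 𝓘(ℝ, EuclideanSpace ℝ (Fin n)) 𝓘(ℝ, EuclideanSpace ℝ (Fin n)) ∞
      ψ.symm ψ.target :=
    contMDiffOn_symm_of_mem_maximalAtlas (IsManifold.subset_maximalAtlas hψ)
  have ht := hs.contMDiffOn_tangentMapWithin (m := ∞) (by simp) ψ.open_target.uniqueMDiffOn
  have hc : ContMDiff 𝓘(ℝ, EuclideanSpace ℝ (Fin n)) (𝓘(ℝ, EuclideanSpace ℝ (Fin n)).tangent) ∞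
      (fun y : EuclideanSpace ℝ (Fin n) => (⟨y, EuclideanSpace.single i (1 : ℝ)⟩ :
        TangentBundle 𝓘(ℝ, EuclideanSpace ℝ (Fin n)) (EuclideanSpace ℝ (Fin n)))) :=
    fun y => contMDiffAt_vectorSpace_iff_contDiffAt.2
      (contDiffAt_const (c := EuclideanSpace.single i (1 : ℝ)))
  have := ht.comp (hc.contMDiffOn (s := ψ.target)) (fun y hy => hy)
  refine (this.contMDiffAt (ψ.open_target.mem_nhds hy)).congr_of_eventuallyEq ?_
  filter_upwards [ψ.open_target.mem_nhds hy] with w hw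
  simp only [tangentMapWithin, coordVec, Function.comp]
  rw [mfderivWithin_of_isOpen ψ.open_target hw]

theorem contDiffAt_metricMatrix (g : SmoothMetric n N)
    {ψ : OpenPartialHomeomorph N (EuclideanSpace ℝ (Fin n))}
    (hψ : ψ ∈ atlas (EuclideanSpace ℝ (Fin n)) N) {y : EuclideanSpace ℝ (Fin n)}
    (hy : y ∈ ψ.target) (i j : Fin n) :
    ContDiffAt ℝ ∞ (fun y => metricMatrix g ψ y i j) y := by
  rw [← contMDiffAt_iff_contDiffAt]
  have hs : ContMDiffAt 𝓘(ℝ, EuclideanSpace ℝ (Fin n)) 𝓘(ℝ, EuclideanSpace ℝ (Fin n)) ∞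
      ψ.symm y :=
    (contMDiffOn_symm_of_mem_maximalAtlas (IsManifold.subset_maximalAtlas hψ)).contMDiffAt
      (ψ.open_target.mem_nhds hy)
  have := ContMDiffAt.clm_bundle_apply₂ (F₁ := EuclideanSpace ℝ (Fin n))
    (F₂ := EuclideanSpace ℝ (Fin n)) (E₃ := Bundle.Trivial N ℝ)
    (g.contMDiff.contMDiffAt.comp y hs) (contMDiffAt_coordVec hψ hy i)
    (contMDiffAt_coordVec hψ hy j)
  simp only [Bundle.contMDiffAt_totalSpace] at this
  exact this.2

theorem metricMatrix_symm (g : SmoothMetric n N)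
    (ψ : OpenPartialHomeomorph N (EuclideanSpace ℝ (Fin n))) (y : EuclideanSpace ℝ (Fin n))
    (i j : Fin n) : metricMatrix g ψ y i j = metricMatrix g ψ y j i :=
  g.symm _ _ _

/-- A kernel vector of the matrix would be carried by the injective differential of `ψ.symm` to a
nonzero tangent vector of length zero. -/
theorem metricMatrix_det_ne_zero (g : SmoothMetric n N)
    {ψ : OpenPartialHomeomorph N (EuclideanSpace ℝ (Fin n))}
    (hψ : ψ ∈ atlas (EuclideanSpace ℝ (Fin n)) N) {y : EuclideanSpace ℝ (Fin n)}
    (hy : y ∈ ψ.target) : (metricMatrix g ψ y).det ≠ 0 := by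
  intro h0
  obtain ⟨v, hv, hgv⟩ := Matrix.exists_mulVec_eq_zero_iff.2 h0
  have hmd : ψ.MDifferentiable 𝓘(ℝ, EuclideanSpace ℝ (Fin n)) 𝓘(ℝ, EuclideanSpace ℝ (Fin n)) :=
    mdifferentiable_of_mem_atlas hψ
  set L := mfderiv 𝓘(ℝ, EuclideanSpace ℝ (Fin n)) 𝓘(ℝ, EuclideanSpace ℝ (Fin n)) ψ.symm y
  have hL : Function.Injective L := hmd.symm.mfderiv_injective hy
  have hsum : L (WithLp.toLp 2 v) = ∑ i, v i • coordVec ψ y i := by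
    have : (WithLp.toLp 2 v : EuclideanSpace ℝ (Fin n))
        = ∑ i, v i • EuclideanSpace.single i (1 : ℝ) := by
      ext k; simp [Finset.sum_apply, Pi.single_apply]
    rw [this]
    exact (map_sum L _ _).trans (Finset.sum_congr rfl fun i _ => map_smul L _ _)
  have hne : L (WithLp.toLp 2 v) ≠ 0 := by
    intro h
    refine hv ?_
    have : (WithLp.toLp 2 v : EuclideanSpace ℝ (Fin n)) = 0 := hL (h.trans (map_zero L).symm)
    simpa using this
  have hpos := g.pos _ _ hne
  have hzero : g.inner (ψ.symm y) (L (WithLp.toLp 2 v)) (L (WithLp.toLp 2 v)) = 0 := by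
    rw [hsum]
    simp only [map_sum, map_smul, sum_apply, smul_apply, smul_eq_mul]
    refine Finset.sum_eq_zero fun i _ => ?_
    have := congrFun hgv i
    simp only [Matrix.mulVec, dotProduct, metricMatrix_symm g ψ y i, Pi.zero_apply] at this
    simp only [metricMatrix, Matrix.of_apply] at this
    simp only [mul_comm (v _), this, zero_mul]
  exact hpos.ne' hzero

theorem christoffel_symm (g : SmoothMetric n N)
    (ψ : OpenPartialHomeomorph N (EuclideanSpace ℝ (Fin n))) (k i j : Fin n) :
    christoffel g ψ k i j = christoffel g ψ k j i := by
  ext y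
  simp only [christoffel, metricMatrix_symm g ψ _ i j]
  congr 1
  exact Finset.sum_congr rfl fun l _ => by ring

theorem differentiableAt_christoffel (g : SmoothMetric n N)
    {ψ : OpenPartialHomeomorph N (EuclideanSpace ℝ (Fin n))}
    (hψ : ψ ∈ atlas (EuclideanSpace ℝ (Fin n)) N) {y : EuclideanSpace ℝ (Fin n)}
    (hy : y ∈ ψ.target) (k i j : Fin n) : DifferentiableAt ℝ (christoffel g ψ k i j) y := by
  have hg := contDiffAt_metricMatrix g hψ hy
  have hdx (a b c : Fin n) :
      DifferentiableAt ℝ (fun y => dx a (fun y' => metricMatrix g ψ y' b c) y) y :=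
    (((hg b c).fderiv_right (m := 1) (by norm_cast)).clm_apply
      contDiffAt_const).differentiableAt (by norm_num)
  have hM (a b : Fin n) : DifferentiableAt ℝ (fun y => metricMatrix g ψ y a b) y :=
    (hg a b).differentiableAt (by simp)
  have hdet (A : EuclideanSpace ℝ (Fin n) → Matrix (Fin n) (Fin n) ℝ)
      (hA : ∀ a b, DifferentiableAt ℝ (fun y => A y a b) y) :
      DifferentiableAt ℝ (fun y => (A y).det) y := by
    simp only [Matrix.det_apply]
    exact DifferentiableAt.fun_sum fun σ _ =>
      (HasFDerivAt.finsetProd fun a _ => (hA _ _).hasFDerivAt).differentiableAt.const_smul _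
  have hinv (a b : Fin n) : DifferentiableAt ℝ (fun y => (metricMatrix g ψ y)⁻¹ a b) y := by
    -- Cramer's rule: each adjugate entry is the determinant of the metric matrix with one row
    -- replaced by a constant vector.
    simp only [Matrix.inv_def, Ring.inverse_eq_inv', Matrix.smul_apply, smul_eq_mul,
      Matrix.adjugate_apply]
    refine ((hdet _ hM).inv (metricMatrix_det_ne_zero g hψ hy)).mul (hdet _ fun c d => ?_)
    simp only [Matrix.updateRow_apply]
    split_ifs
    · exact differentiableAt_const _
    · exact hM _ _
  unfold christoffel
  exact (DifferentiableAt.fun_sum fun l _ =>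
    (hinv k l).mul (((hdx i j l).add (hdx j i l)).sub (hdx l i j))).const_mul _

end Riemannian

/-! ### Contraction with $UU^*$, rank bounds and passage to charts -/

section PluriHarmonic

theorem sum_sum_sum_sum_rotate {ι κ R : Type*} [AddCommMonoid R] (s : Finset ι) (t : Finset κ)
    (f : κ → ι → ι → ι → R) :
    ∑ i ∈ s, ∑ j ∈ s, ∑ k ∈ s, ∑ a ∈ t, f a i j k
      = ∑ a ∈ t, ∑ i ∈ s, ∑ j ∈ s, ∑ k ∈ s, f a i j k :=
  (Finset.sum_congr rfl fun _ _ =>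
    (Finset.sum_congr rfl fun _ _ => Finset.sum_comm).trans Finset.sum_comm).trans Finset.sum_comm

/-- The contraction of a tensor `R` that satisfies `R(U_α, U_β, conj U_β, ·) = 0` with the
Hermitian matrix `U * Uᴴ`. -/
theorem sum_mul_conjTranspose_eq_zero {ι κ : Type*} [Fintype ι] [Fintype κ]
    (R : ι → ι → ι → ι → ℂ) (U : Matrix ι κ ℂ)
    (h : ∀ α β l, ∑ i, ∑ j, ∑ k, R i j k l * U i α * U j β * starRingEnd ℂ (U k β) = 0) :
    ∑ i, ∑ j, ∑ k, ∑ l, R i j k l * (U * U.conjTranspose) i l * (U * U.conjTranspose) j k = 0 := by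
  calc ∑ i, ∑ j, ∑ k, ∑ l, R i j k l * (U * U.conjTranspose) i l * (U * U.conjTranspose) j k
      = ∑ i, ∑ j, ∑ k, ∑ l, ∑ α, ∑ β, R i j k l * U i α * U j β * starRingEnd ℂ (U k β)
          * starRingEnd ℂ (U l α) := by
        simp only [Matrix.mul_apply, Matrix.conjTranspose_apply, Finset.mul_sum, Finset.sum_mul]
        refine Finset.sum_congr rfl fun i _ => Finset.sum_congr rfl fun j _ =>
          Finset.sum_congr rfl fun k _ => Finset.sum_congr rfl fun l _ => ?_
        rw [Finset.sum_comm]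
        refine Finset.sum_congr rfl fun α _ => Finset.sum_congr rfl fun β _ => ?_
        simp only [RCLike.star_def]
        ring
    _ = ∑ l, ∑ α, ∑ β, (∑ i, ∑ j, ∑ k, R i j k l * U i α * U j β * starRingEnd ℂ (U k β))
          * starRingEnd ℂ (U l α) := by
        rw [sum_sum_sum_sum_rotate]
        refine Finset.sum_congr rfl fun l _ => ?_
        rw [sum_sum_sum_sum_rotate]
        refine Finset.sum_congr rfl fun α _ => ?_
        rw [sum_sum_sum_sum_rotate]
        simp only [Finset.sum_mul]
    _ = 0 := by
        simp only [h, zero_mul, Finset.sum_const_zero]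

/-- If the complex matrix of the differential `∂F` has rank at most one, the real differential
has rank at most two. -/
theorem rank_fderiv_le_two {m n : ℕ}
    {F : EuclideanSpace ℂ (Fin m) → EuclideanSpace ℝ (Fin n)} {z : EuclideanSpace ℂ (Fin m)}
    (hF : DifferentiableAt ℝ F z)
    (h : (Matrix.of fun i α => dz α (fun z => ((F z i : ℝ) : ℂ)) z :
      Matrix (Fin n) (Fin m) ℂ).rank ≤ 1) :
    (fderiv ℝ F z).toLinearMap.rank ≤ 2 := by
  set U : Matrix (Fin n) (Fin m) ℂ := Matrix.of fun i α => dz α (fun z => ((F z i : ℝ) : ℂ)) z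
  -- `T` is $v\mapsto 2\,\mathrm{Re}\,v$, so that $df(w)=T(Uw)$.
  let T : (Fin n → ℂ) →ₗ[ℝ] EuclideanSpace ℝ (Fin n) :=
    (WithLp.linearEquiv 2 ℝ (Fin n → ℝ)).symm.toLinearMap ∘ₗ
      LinearMap.pi fun i => (2 : ℝ) • (Complex.reLm ∘ₗ LinearMap.proj i)
  let W : Submodule ℝ (Fin n → ℂ) := (LinearMap.range U.mulVecLin).restrictScalars ℝ
  have hle : LinearMap.range (fderiv ℝ F z).toLinearMap ≤ W.map T := by
    rintro _ ⟨w, rfl⟩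
    refine ⟨U.mulVec w, ⟨w, rfl⟩, ?_⟩
    ext i
    rw [ContinuousLinearMap.coe_coe, fderiv_component_eq_re_sum hF]
    simp [T, U, Matrix.mulVec, dotProduct, ← Finset.mul_sum]
  have hW : Module.finrank ℝ W ≤ 2 := by
    -- The real dimension is twice the complex one, which is the source of the bound 2.
    have h1 := Module.finrank_mul_finrank ℝ ℂ (LinearMap.range U.mulVecLin)
    rw [Complex.finrank_real_complex] at h1
    change Module.finrank ℝ (LinearMap.range U.mulVecLin) ≤ 2
    have h2 : Module.finrank ℂ (LinearMap.range U.mulVecLin) ≤ 1 := h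
    omega
  have hfin : Module.finrank ℝ (LinearMap.range (fderiv ℝ F z).toLinearMap) ≤ 2 :=
    (Submodule.finrank_mono hle).trans ((Submodule.finrank_map_le T W).trans hW)
  rw [LinearMap.rank, ← Module.finrank_eq_rank]
  exact_mod_cast hfin

variable {m n : ℕ} {M : Type*} [TopologicalSpace M] [ChartedSpace (EuclideanSpace ℂ (Fin m)) M]
  {N : Type*} [TopologicalSpace N] [ChartedSpace (EuclideanSpace ℝ (Fin n)) N]

/-- The map `f` in the preferred charts at `p` and `f p`. -/
def inCharts (m n : ℕ) {M : Type*} [TopologicalSpace M]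
    [ChartedSpace (EuclideanSpace ℂ (Fin m)) M] {N : Type*} [TopologicalSpace N]
    [ChartedSpace (EuclideanSpace ℝ (Fin n)) N] (f : M → N) (p : M)
    (z : EuclideanSpace ℂ (Fin m)) : EuclideanSpace ℝ (Fin n) :=
  chartAt (EuclideanSpace ℝ (Fin n)) (f p) (f ((chartAt (EuclideanSpace ℂ (Fin m)) p).symm z))

theorem contDiffAt_inCharts {f : M → N} {p : M} (hf : ContMDiffAt 𝓘(ℝ, EuclideanSpace ℂ (Fin m))
      𝓘(ℝ, EuclideanSpace ℝ (Fin n)) ∞ f p) :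
    ContDiffAt ℝ ∞ (inCharts m n f p) (chartAt (EuclideanSpace ℂ (Fin m)) p p) := by
  have := (contMDiffAt_iff.1 hf).2
  simp only [mfld_simps, contDiffWithinAt_univ] at this
  exact this

theorem mfderiv_eq_fderiv_inCharts {f : M → N} {p : M}
    (hf : MDifferentiableAt 𝓘(ℝ, EuclideanSpace ℂ (Fin m)) 𝓘(ℝ, EuclideanSpace ℝ (Fin n)) f p) :
    mfderiv 𝓘(ℝ, EuclideanSpace ℂ (Fin m)) 𝓘(ℝ, EuclideanSpace ℝ (Fin n)) f p
      = fderiv ℝ (inCharts m n f p) (chartAt (EuclideanSpace ℂ (Fin m)) p p) := by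
  rw [hf.mfderiv]
  simp only [mfld_simps, fderivWithin_univ]
  rfl

variable [IsManifold 𝓘(ℝ, EuclideanSpace ℝ (Fin n)) ∞ N]

theorem IsPluriHarmonic.eventually_equation {g : SmoothMetric n N} {f : M → N}
    (hf : IsPluriHarmonic (m := m) g f) (p : M) :
    ∀ᶠ z in nhds (chartAt (EuclideanSpace ℂ (Fin m)) p p), ∀ (α β : Fin m) (i : Fin n),
      dz α (dzbar β (fun z => ((inCharts m n f p z i : ℝ) : ℂ))) z
        + ∑ j, ∑ k, (christoffel g (chartAt (EuclideanSpace ℝ (Fin n)) (f p)) i j k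
            (inCharts m n f p z) : ℂ)
          * dzbar β (fun z => ((inCharts m n f p z j : ℝ) : ℂ)) z
          * dz α (fun z => ((inCharts m n f p z k : ℝ) : ℂ)) z = 0 := by
  set φ := chartAt (EuclideanSpace ℂ (Fin m)) p
  set ψ := chartAt (EuclideanSpace ℝ (Fin n)) (f p)
  have hp : φ p ∈ φ.target := mem_chart_target _ p
  have hc : ContinuousAt (fun z => f (φ.symm z)) (φ p) :=
    hf.smooth.continuous.continuousAt.comp (φ.continuousAt_symm hp)
  have hs : ∀ᶠ z in nhds (φ p), f (φ.symm z) ∈ ψ.source := by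
    refine hc.eventually_mem (ψ.open_source.mem_nhds ?_)
    rw [φ.left_inv (mem_chart_source _ p)]
    exact mem_chart_source _ (f p)
  filter_upwards [φ.open_target.mem_nhds hp, hs] with z hz hz'
  exact hf.equation φ (chart_mem_atlas _ p) ψ (chart_mem_atlas _ (f p)) z hz hz'

theorem curvature_dz_dz_dzbar {g : SmoothMetric n N} {f : M → N}
    (hf : IsPluriHarmonic (m := m) g f) (p : M) (α γ β : Fin m) (l : Fin n) :
    ∑ i, ∑ j, ∑ k, (curvature g (chartAt (EuclideanSpace ℝ (Fin n)) (f p)) i j k l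
        (chartAt (EuclideanSpace ℝ (Fin n)) (f p) (f p)) : ℂ)
      * dz α (fun z => ((inCharts m n f p z i : ℝ) : ℂ)) (chartAt (EuclideanSpace ℂ (Fin m)) p p)
      * dz γ (fun z => ((inCharts m n f p z j : ℝ) : ℂ)) (chartAt (EuclideanSpace ℂ (Fin m)) p p)
      * dzbar β (fun z => ((inCharts m n f p z k : ℝ) : ℂ))
          (chartAt (EuclideanSpace ℂ (Fin m)) p p) = 0 := by
  have hz : inCharts m n f p (chartAt (EuclideanSpace ℂ (Fin m)) p p)
      = chartAt (EuclideanSpace ℝ (Fin n)) (f p) (f p) := by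
    simp [inCharts]
  set ψ := chartAt (EuclideanSpace ℝ (Fin n)) (f p)
  have hF := (contDiffAt_inCharts (hf.smooth p)).of_le (m := 3) (by norm_cast)
  have key := curvature_integrability (Γ := christoffel g ψ) hF
    (fun i j k => by
      rw [hz]
      exact differentiableAt_christoffel g (chart_mem_atlas _ (f p)) (mem_chart_target _ (f p))
        i j k)
    (christoffel_symm g ψ) (hf.eventually_equation p) α γ β
  rw [hz] at key
  -- Lower the free upper index `q` of the integrability condition with $g_{q\ell}$.
  have hsum := Finset.sum_eq_zero (s := Finset.univ) fun q (_ : q ∈ Finset.univ) =>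
    (congrArg (fun x => (metricMatrix g ψ (ψ (f p)) q l : ℂ) * x) (key q)).trans (mul_zero _)
  rw [← hsum]
  simp only [curvature, Complex.ofReal_sum, Complex.ofReal_mul, Finset.mul_sum, Finset.sum_mul]
  rw [sum_sum_sum_sum_rotate]
  refine Finset.sum_congr rfl fun q _ => Finset.sum_congr rfl fun i _ =>
    Finset.sum_congr rfl fun j _ => Finset.sum_congr rfl fun k _ => ?_
  ring

theorem rank_dz_le_one {g : SmoothMetric n N} {f : M → N}
    (hf : IsPluriHarmonic (m := m) g f) (p : M) (hp : HermitianNondegenerateAt g (f p)) :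
    (Matrix.of fun i α => dz α (fun z => ((inCharts m n f p z i : ℝ) : ℂ))
      (chartAt (EuclideanSpace ℂ (Fin m)) p p) : Matrix (Fin n) (Fin m) ℂ).rank ≤ 1 := by
  set U : Matrix (Fin n) (Fin m) ℂ := Matrix.of fun i α =>
    dz α (fun z => ((inCharts m n f p z i : ℝ) : ℂ)) (chartAt (EuclideanSpace ℂ (Fin m)) p p)
    with hU
  -- Passing from $U$ to $UU^*$ keeps the rank and gives a matrix to which the non-degeneracy
  -- hypothesis applies.
  rw [← Matrix.rank_self_mul_conjTranspose]
  refine hp _ (Matrix.posSemidef_self_mul_conjTranspose U) ?_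
  have hd : DifferentiableAt ℝ (inCharts m n f p) (chartAt (EuclideanSpace ℂ (Fin m)) p p) :=
    (contDiffAt_inCharts (hf.smooth p)).differentiableAt (by simp)
  have h0 (α β : Fin m) (l : Fin n) : ∑ i, ∑ j, ∑ k,
      (curvature g (chartAt (EuclideanSpace ℝ (Fin n)) (f p)) i j k l
        (chartAt (EuclideanSpace ℝ (Fin n)) (f p) (f p)) : ℂ)
        * U i α * U j β * starRingEnd ℂ (U k β) = 0 := by
    rw [← curvature_dz_dz_dzbar hf p α β β l]
    simp only [dzbar_ofReal_component hd, hU, Matrix.of_apply]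
  exact sum_mul_conjTranspose_eq_zero (fun i j k l => (curvature g
    (chartAt (EuclideanSpace ℝ (Fin n)) (f p)) i j k l
    (chartAt (EuclideanSpace ℝ (Fin n)) (f p) (f p)) : ℂ)) U h0

end PluriHarmonic

end

theorem theorem7 {m n : ℕ}
    {M : Type*} [TopologicalSpace M] [CompactSpace M]
    [ChartedSpace (EuclideanSpace ℂ (Fin m)) M]
    [IsManifold 𝓘(ℂ, EuclideanSpace ℂ (Fin m)) ω M]
    {N : Type*} [TopologicalSpace N]
    [ChartedSpace (EuclideanSpace ℝ (Fin n)) N]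
    [IsManifold 𝓘(ℝ, EuclideanSpace ℝ (Fin n)) ∞ N]
    (g : SmoothMetric n N) (f : M → N) (hf : IsPluriHarmonic (m := m) g f)
    (p : M) (hp : HermitianNondegenerateAt g (f p)) :
    (mfderiv 𝓘(ℝ, EuclideanSpace ℂ (Fin m)) 𝓘(ℝ, EuclideanSpace ℝ (Fin n)) f p).toLinearMap.rank
      ≤ 2 := by
  have hd : DifferentiableAt ℝ (inCharts m n f p) (chartAt (EuclideanSpace ℂ (Fin m)) p p) :=
    (contDiffAt_inCharts (hf.smooth p)).differentiableAt (by simp)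
  rw [mfderiv_eq_fderiv_inCharts ((hf.smooth p).mdifferentiableAt (by simp))]
  exact rank_fderiv_le_two hd (rank_dz_le_one hf p hp)
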